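/- Let $S$ be a monoid with a finite homogeneous presentation. That is, $S$ is generated by a finite set $X$, there is a weight function $d\colon X\to\mathbb Z_{>0}$, extended to words by $d(x_1\cdots x_k)=d(x_1)+\dots+d(x_k)$, and either $S$ is presented as a monoid by $X$ and finitely many relations of the form $w=u$, where $w,u$ are words with $d(w)=d(u)$; or $S$ has a zero and is presented as a monoid with zero by $X$ and finitely many relations, each of the form $w=u$ with $d(w)=d(u)$ or of the form $w=0$. For $a,w,b\in S$ call the set $a\langle w\rangle b=\{aw^nb : n\ge 0\}$ a sandwich; it is called free if the elements $aw^nb$, $n\ge 0$, are pairwise different. Then the following conditions are equivalent. (i) $S$ has at most linear growth: for some (equivalently, every) finite set $G$ generating $S$ as a monoid there is a constant $C$ such that, for every $n\ge 1$, at most $Cn$ elements of $S$ are products of at most $n$ elements of $G$. (ii) $S$ is a finite union of sandwiches. (iii) $S$ is the union of a finite subset and a finite (possibly empty) disjoint union of free sandwiches. -/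

import Mathlib

/-- The weight `d(w) = d(x₁) + ⋯ + d(x_k)` of a word `w = x₁ ⋯ x_k`. -/
def wordWeight {X : Type*} (d : X → ℕ) (w : FreeMonoid X) : ℕ :=
  (w.toList.map d).sum

/-- `S` is the monoid (without an adjoined zero) presented by finitely many generators, which carry
positive integer weights, and finitely many relations `w = u` with `d(w) = d(u)`. -/
def HasFiniteHomogeneousPresentation (S : Type*) [Monoid S] : Prop :=
  ∃ (k : ℕ) (d : Fin k → ℕ) (R : Set (FreeMonoid (Fin k) × FreeMonoid (Fin k))),
    (∀ x, 0 < d x) ∧ R.Finite ∧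
    (∀ p ∈ R, wordWeight d p.1 = wordWeight d p.2) ∧
    Nonempty (PresentedMonoid (fun w u => (w, u) ∈ R) ≃* S)

/-- `S` is the monoid with zero presented by finitely many generators, which carry positive integer
weights, and finitely many relations, each of the form `w = u` with `d(w) = d(u)` or of the form
`w = 0`. The free monoid with zero on the generators is `WithZero (FreeMonoid (Fin k))`, the set of
all words together with a zero. -/
def HasFiniteHomogeneousPresentationWithZero (S : Type*) [Monoid S] : Prop :=
  ∃ (k : ℕ) (d : Fin k → ℕ)
    (R : Set (WithZero (FreeMonoid (Fin k)) × WithZero (FreeMonoid (Fin k)))),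
    (∀ x, 0 < d x) ∧ R.Finite ∧
    (∀ p ∈ R,
      (∃ w u : FreeMonoid (Fin k),
        p = ((w : WithZero (FreeMonoid (Fin k))), (u : WithZero (FreeMonoid (Fin k)))) ∧
          wordWeight d w = wordWeight d u) ∨
      (∃ w : FreeMonoid (Fin k), p = ((w : WithZero (FreeMonoid (Fin k))), 0))) ∧
    Nonempty ((conGen (fun w u => (w, u) ∈ R)).Quotient ≃* S)

/-- Homogeneous finitely presented monoids, with or without zero. -/
def IsHomogeneousFinitelyPresented (S : Type*) [Monoid S] : Prop :=
  HasFiniteHomogeneousPresentation S ∨ HasFiniteHomogeneousPresentationWithZero S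

/-- The elements of `S` that are products of at most `n` elements of `G`. -/
def growthBall {S : Type*} [Monoid S] (G : Set S) (n : ℕ) : Set S :=
  {s | ∃ l : List S, l.length ≤ n ∧ (∀ x ∈ l, x ∈ G) ∧ l.prod = s}

/-- At most linear growth: with respect to a finite generating set `G`, the number of elements of
`S` that are products of at most `n` generators is at most `C * n` for all `n ≥ 1`. (These sets are
finite because `G` is finite.) -/
def HasAtMostLinearGrowth (S : Type*) [Monoid S] : Prop :=
  ∃ G : Set S, G.Finite ∧ Submonoid.closure G = ⊤ ∧
    ∃ C : ℕ, ∀ n : ℕ, 1 ≤ n → (growthBall G n).ncard ≤ C * n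

/-- The sandwich `a⟨w⟩b = {a wⁿ b | n ≥ 0}`. -/
def sandwich {S : Type*} [Monoid S] (a w b : S) : Set S :=
  Set.range (fun n : ℕ => a * w ^ n * b)

/-- The sandwich `a⟨w⟩b` is free: the elements `a wⁿ b`, `n ≥ 0`, are pairwise different. -/
def IsFreeSandwich {S : Type*} [Monoid S] (a w b : S) : Prop :=
  Function.Injective (fun n : ℕ => a * w ^ n * b)

/-- `S` is a finite union of sandwiches. -/
def IsFiniteUnionOfSandwiches (S : Type*) [Monoid S] : Prop :=
  ∃ (k : ℕ) (a w b : Fin k → S), (⋃ i, sandwich (a i) (w i) (b i)) = Set.univ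

/-- `S` is the union of a finite subset and a finite disjoint union of free sandwiches. -/
def HasSandwichDecomposition (S : Type*) [Monoid S] : Prop :=
  ∃ (F : Set S) (k : ℕ) (a w b : Fin k → S),
    F.Finite ∧
    (∀ i, IsFreeSandwich (a i) (w i) (b i)) ∧
    (∀ i j, i ≠ j → Disjoint (sandwich (a i) (w i) (b i)) (sandwich (a j) (w j) (b j))) ∧
    F ∪ (⋃ i, sandwich (a i) (w i) (b i)) = Set.univ

/-!
The condition (iii) obviously implies (ii). The other implications rest on three ideas.

*Linear growth gives sandwiches.* This holds in every finitely generated monoid. Represent each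
element by its shortlex-minimal word; these words form a factor-closed language. If `p(m)` is the
number of its words of length `m`, then linear growth bounds `p(0) + ⋯ + p(n)` by `C n`, so
`p(m) ≤ m` for some `m` (`exists_ncard_minimalWords_le`). By the Morse–Hedlund argument
(`exists_power_form`) every word of the language then has the form `x uⁿ y` with `x`, `u`, `y` of
bounded length.

*Sandwiches give linear growth.* Outside the zero, the relations preserve the weight. After
subdividing the sandwiches one may assume that all middle factors have the same weight `E` and that
all starting weights lie in one interval `[c, c + E)` (`GradedPresentation.nonempty_uniformCover`).
Then each sandwich contains at most one nonzero element of each weight.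

*Sandwiches give a free decomposition.* This is where finitely many relations are needed. Let `ρ`
be at least the weight of each side of each relation. The right action of the letters on the nonzero elements of weight at least `n`
is determined by what happens in the window `[n, n + ρ)`: a relation is applied either inside the
window or to the right of a prefix of weight at least `n`
(`GradedPresentation.Transfers.mul_eq_mul`). The elements of a window are labelled by the sandwiches,
so the description of a window is one of finitely many, and two windows, at `E N + c` and `E M + c`,
have the same description. Hence with `p = M - N` the equalities among the elements `aᵢ wᵢⁿ bᵢ`, and
the question which of them vanish, depend on `n` only modulo `p`, for large `n`
(`GradedPresentation.UniformCover.exists_period`). The nonzero values over one period, each taken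
once, are the starting points of disjoint free sandwiches with middle factors `wᵢ ^ p`.
-/

/-! ### Words with few factors -/

/-- A list with period `p` is a power of its prefix of length `p`, followed by a shorter list. -/
theorem List.exists_eq_replicate_flatten_append {α : Type*} {p : ℕ} (hp : 0 < p) (z : List α)
    (hz : ∀ t, t + p < z.length → z[t]? = z[t + p]?) :
    ∃ (n : ℕ) (r : List α), r.length < p ∧ z = (List.replicate n (z.take p)).flatten ++ r := by
  induction hl : z.length using Nat.strong_induction_on generalizing z with
  | _ l ih =>
    subst hl
    by_cases h : z.length < p
    · exact ⟨0, z, h, by simp⟩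
    push Not at h
    by_cases h2 : (z.drop p).length < p
    · exact ⟨1, z.drop p, h2, by simp⟩
    push Not at h2
    obtain ⟨n, r, hr, hn⟩ := ih (z.drop p).length (by simp; omega) (z.drop p) (by
      intro t ht
      simp only [List.length_drop] at ht
      rw [List.getElem?_drop, List.getElem?_drop, hz _ (by omega)]
      congr 1; omega) rfl
    have hu : (z.drop p).take p = z.take p := by
      apply List.ext_getElem?
      intro i
      simp only [List.length_drop] at h2
      by_cases hi : i < p
      · rw [List.getElem?_take_of_lt hi, List.getElem?_take_of_lt hi, List.getElem?_drop,
          hz i (by omega), add_comm]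
      · rw [List.getElem?_eq_none (by simp; omega), List.getElem?_eq_none (by simp; omega)]
    refine ⟨n + 1, r, hr, ?_⟩
    rw [hu] at hn
    rw [List.replicate_succ, List.flatten_cons, List.append_assoc, ← hn, List.take_append_drop]

/-- The factors of length `j` of `v` that start before position `T`. -/
def factorsFrom {α : Type*} (v : List α) (T j : ℕ) : Set (List α) :=
  (fun s => (v.drop s).take j) '' Set.Iio T

theorem finite_factorsFrom {α : Type*} (v : List α) (T j : ℕ) : (factorsFrom v T j).Finite :=
  (Set.finite_Iio T).image _

theorem take_image_factorsFrom {α : Type*} (v : List α) (T j : ℕ) :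
    List.take j '' factorsFrom v T (j + 1) = factorsFrom v T j := by
  simp [factorsFrom, Set.image_image, List.take_take]

/-- A word with at most `m` factors of length `m` is, up to a prefix and a suffix of bounded length,
a power of a word of bounded length. This is the Morse–Hedlund argument: the number of factors of
length `j` cannot increase strictly for all `j < m`, and where it does not increase, each factor of
length `j` determines the letter that follows it. -/
theorem exists_power_form {α : Type*} (v : List α) (m : ℕ)
    (hfin : {f : List α | f <:+: v ∧ f.length = m}.Finite)
    (h : {f : List α | f <:+: v ∧ f.length = m}.ncard ≤ m) :
    ∃ (x u y : List α) (n : ℕ), x.length ≤ 2 * m ∧ u.length ≤ 2 * m ∧ y.length ≤ 2 * m ∧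
      v = x ++ (List.replicate n u).flatten ++ y := by
  by_cases hv : v.length < 2 * m
  · exact ⟨v, [], [], 0, hv.le, by simp, by simp, by simp⟩
  push Not at hv
  obtain ⟨T, hT⟩ : ∃ T, T = v.length - m + 1 := ⟨_, rfl⟩
  have hAm : (factorsFrom v T m).ncard ≤ m := by
    refine (Set.ncard_le_ncard ?_ hfin).trans h
    rintro _ ⟨s, hs, rfl⟩
    refine ⟨(List.take_prefix _ _).isInfix.trans (List.drop_suffix _ _).isInfix, ?_⟩
    simp only [Set.mem_Iio] at hs
    simp; omega
  have hmono : ∀ j, (factorsFrom v T j).ncard ≤ (factorsFrom v T (j + 1)).ncard := fun j => by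
    rw [← take_image_factorsFrom]; exact Set.ncard_image_le (finite_factorsFrom _ _ _)
  obtain ⟨j, hj, hjle⟩ : ∃ j < m, (factorsFrom v T (j + 1)).ncard ≤ (factorsFrom v T j).ncard := by
    by_contra! hcon
    have key : ∀ j ≤ m, j + 1 ≤ (factorsFrom v T j).ncard := by
      intro j
      induction j with
      | zero =>
        intro _
        rw [Nat.zero_add, Nat.one_le_iff_ne_zero, ← Nat.pos_iff_ne_zero,
          Set.ncard_pos (finite_factorsFrom _ _ _)]
        exact ⟨_, 0, by simp [hT], rfl⟩
      | succ j ih =>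
        intro hj
        have := hcon j (by omega)
        have := ih (by omega)
        omega
    have := key m le_rfl
    omega
  have hinj : Set.InjOn (List.take j) (factorsFrom v T (j + 1)) := by
    apply Set.injOn_of_ncard_image_eq _ (finite_factorsFrom _ _ _)
    rw [take_image_factorsFrom]
    exact le_antisymm (hmono j) hjle
  have hjm : (factorsFrom v T j).ncard ≤ m := by
    have : ∀ i, j ≤ i → (factorsFrom v T j).ncard ≤ (factorsFrom v T i).ncard := by
      intro i hi
      induction i, hi using Nat.le_induction with
      | base => exact le_rfl
      | succ i _ ih => exact ih.trans (hmono i)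
    exact (this m hj.le).trans hAm
  obtain ⟨s₁, s₂, hlt, hs₂, heq⟩ : ∃ s₁ s₂, s₁ < s₂ ∧ s₂ ≤ m ∧
      (v.drop s₁).take j = (v.drop s₂).take j := by
    obtain ⟨a, ha, b, hb, hab, he⟩ := Finset.exists_ne_map_eq_of_card_lt_of_maps_to
      (s := Finset.range (m + 1)) (t := (finite_factorsFrom v T j).toFinset)
      (f := fun s => (v.drop s).take j)
      (by rw [← Set.ncard_eq_toFinset_card _ (finite_factorsFrom v T j), Finset.card_range]; omega)
      (by
        intro s hs
        simp only [Finset.coe_range, Set.mem_Iio] at hs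
        simp only [Set.Finite.coe_toFinset]
        exact ⟨s, by simp only [Set.mem_Iio]; omega, rfl⟩)
    simp only [Finset.mem_range] at ha hb
    rcases lt_or_gt_of_ne hab with hlt | hlt
    · exact ⟨a, b, hlt, by omega, he⟩
    · exact ⟨b, a, hlt, by omega, he.symm⟩
  have hext : ∀ t, s₂ + t < T → (v.drop (s₁ + t)).take j = (v.drop (s₂ + t)).take j →
      (v.drop (s₁ + t)).take (j + 1) = (v.drop (s₂ + t)).take (j + 1) := by
    intro t ht he
    refine hinj ⟨s₁ + t, by simp only [Set.mem_Iio]; omega, rfl⟩ ⟨s₂ + t, ht, rfl⟩ ?_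
    simpa [List.take_take] using he
  have hper : ∀ t, s₂ + t < T → (v.drop (s₁ + t)).take j = (v.drop (s₂ + t)).take j := by
    intro t
    induction t with
    | zero => intro _; exact heq
    | succ t ih =>
      intro ht
      have := congrArg (List.drop 1) (hext t (by omega) (ih (by omega)))
      simpa [List.drop_take, List.drop_drop, add_assoc] using this
  have hletter : ∀ t, s₂ + t < T → v[s₁ + t]? = v[s₂ + t]? := by
    intro t ht
    have := congrArg (fun l => l[0]?) (hext t ht (hper t ht))
    simpa [List.getElem?_take_of_lt, List.getElem?_drop] using this
  obtain ⟨n, r, hr, hz⟩ := List.exists_eq_replicate_flatten_append (p := s₂ - s₁) (by omega)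
    ((v.drop s₁).take (T - s₁)) (by
      intro t ht
      simp only [List.length_take, List.length_drop] at ht
      rw [List.getElem?_take_of_lt (by omega), List.getElem?_take_of_lt (by omega),
        List.getElem?_drop, List.getElem?_drop, hletter t (by omega)]
      congr 1; omega)
  refine ⟨v.take s₁, ((v.drop s₁).take (T - s₁)).take (s₂ - s₁), r ++ v.drop T, n, ?_, ?_, ?_, ?_⟩
  · simp; omega
  · simp; omega
  · simp; omega
  · rw [List.append_assoc, ← List.append_assoc _ r, ← hz]
    have : v.drop T = (v.drop s₁).drop (T - s₁) := by
      rw [List.drop_drop]; congr 1; omega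
    rw [this, List.take_append_drop, List.take_append_drop]

/-! ### Linear growth gives sandwiches -/

theorem isFiniteUnionOfSandwiches_of_finite {S ι : Type*} [Monoid S] [Finite ι] (a w b : ι → S)
    (h : ∀ s, ∃ i, s ∈ sandwich (a i) (w i) (b i)) : IsFiniteUnionOfSandwiches S := by
  let e := Finite.equivFin ι
  refine ⟨Nat.card ι, a ∘ e.symm, w ∘ e.symm, b ∘ e.symm, Set.eq_univ_of_forall fun s => ?_⟩
  obtain ⟨i, hi⟩ := h s
  exact Set.mem_iUnion.2 ⟨e i, by simpa using hi⟩

theorem finite_growthBall {S : Type*} [Monoid S] {G : Set S} (hG : G.Finite) (n : ℕ) :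
    (growthBall G n).Finite := by
  have := hG.to_subtype
  refine ((List.finite_length_le G n).image fun l => (l.map Subtype.val).prod).subset ?_
  rintro s ⟨l, hl, hlG, rfl⟩
  lift l to List G using hlG
  exact ⟨l, by simpa using hl, rfl⟩

/-- The words that are shortlex-minimal among the words with the same value in `S`. -/
def minimalWords {S : Type*} [Monoid S] {k : ℕ} (f : Fin k → S) : Set (List (Fin k)) :=
  {v | ∀ v', (v'.map f).prod = (v.map f).prod → ¬ List.Shortlex (· < ·) v' v}

theorem List.Lex.append_right_of_length_eq {α : Type*} {r : α → α → Prop} {s t : List α}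
    (h : List.Lex r s t) (hl : s.length = t.length) (u : List α) :
    List.Lex r (s ++ u) (t ++ u) := by
  induction h with
  | nil => simp at hl
  | cons _ ih => exact List.Lex.cons (ih (by simpa using hl))
  | rel h => exact List.Lex.rel h

theorem mem_minimalWords_of_infix {S : Type*} [Monoid S] {k : ℕ} {f : Fin k → S}
    {v v' : List (Fin k)} (hv : v ∈ minimalWords f) (h : v' <:+: v) : v' ∈ minimalWords f := by
  obtain ⟨x, y, rfl⟩ := h
  intro w hw hlt
  refine hv (x ++ w ++ y) (by simp [hw]) ?_
  rcases List.shortlex_def.1 hlt with hl | ⟨hl, hlex⟩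
  · exact List.Shortlex.of_length_lt (by simp [hl])
  · refine List.Shortlex.of_lex (by simp [hl]) ?_
    exact (List.Lex.append_left _ hlex x).append_right_of_length_eq (by simp [hl]) y

theorem exists_minimalWord {S : Type*} [Monoid S] {k : ℕ} (f : Fin k → S)
    (hf : Submonoid.closure (Set.range f) = ⊤) (s : S) :
    ∃ v ∈ minimalWords f, (v.map f).prod = s := by
  have hne : {v : List (Fin k) | (v.map f).prod = s}.Nonempty := by
    have hs : s ∈ Submonoid.closure (Set.range f) := hf ▸ Submonoid.mem_top s
    obtain ⟨l, hl, rfl⟩ := Submonoid.exists_list_of_mem_closure hs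
    have : l ∈ Set.range (List.map f) := by rw [Set.range_list_map]; exact hl
    obtain ⟨v, rfl⟩ := this
    exact ⟨v, rfl⟩
  have wf : WellFounded (List.Shortlex (α := Fin k) (· < ·)) := List.Shortlex.wf wellFounded_lt
  refine ⟨wf.min _ hne, fun v' h' => wf.not_lt_min _ ?_, wf.min_mem _ hne⟩
  exact h'.trans (wf.min_mem _ hne)

theorem injOn_minimalWords {S : Type*} [Monoid S] {k : ℕ} (f : Fin k → S) :
    Set.InjOn (fun v => (v.map f).prod) (minimalWords f) := by
  intro v hv v' hv' h
  exact Std.Trichotomous.trichotomous (r := List.Shortlex (α := Fin k) (· < ·)) v v'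
    (hv' v h) (hv v' h.symm)

/-- At most linear growth forces `p(m) ≤ m` for some `m`, where `p(m)` is the number of minimal
words of length `m`, since the sum of `p(0), …, p(n)` is at most `C n`. -/
theorem exists_ncard_minimalWords_le {S : Type*} [Monoid S] {k : ℕ} (f : Fin k → S) {C : ℕ}
    (hC : ∀ n : ℕ, 1 ≤ n → (growthBall (Set.range f) n).ncard ≤ C * n) :
    ∃ m, {v ∈ minimalWords f | v.length = m}.ncard ≤ m := by
  by_contra! hcon
  have hfin : ∀ n, {v ∈ minimalWords f | v.length ≤ n}.Finite := fun n =>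
    (List.finite_length_le (Fin k) n).subset fun v hv => hv.2
  have hfin' : ∀ n, {v ∈ minimalWords f | v.length = n}.Finite := fun n =>
    (List.finite_length_eq (Fin k) n).subset fun v hv => hv.2
  have hsum : ∀ n, n * (n + 1) ≤ 2 * {v ∈ minimalWords f | v.length ≤ n}.ncard := by
    intro n
    induction n with
    | zero => simp
    | succ n ih =>
      have hu : {v ∈ minimalWords f | v.length ≤ n + 1} =
          {v ∈ minimalWords f | v.length ≤ n} ∪ {v ∈ minimalWords f | v.length = n + 1} := by
        ext v
        simp only [Set.mem_ofPred_eq, Set.mem_union, ← and_or_left, Nat.le_add_one_iff]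
      rw [hu, Set.ncard_union_eq ?_ (hfin n) (hfin' _)]
      · have := hcon (n + 1)
        nlinarith
      · rw [Set.disjoint_left]
        rintro v ⟨_, h1⟩ ⟨_, h2⟩
        omega
  have hball : ∀ n, {v ∈ minimalWords f | v.length ≤ n}.ncard ≤
      (growthBall (Set.range f) n).ncard := by
    intro n
    refine Set.ncard_le_ncard_of_injOn (fun v => (v.map f).prod) ?_
      ((injOn_minimalWords f).mono fun v hv => hv.1) (finite_growthBall (Set.finite_range f) n)
    rintro v ⟨_, hv⟩
    exact ⟨v.map f, by simpa using hv, by simp, rfl⟩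
  have h1 := hsum (2 * C + 1)
  have h2 := hball (2 * C + 1)
  have h3 := hC (2 * C + 1) (by omega)
  nlinarith

theorem HasAtMostLinearGrowth.isFiniteUnionOfSandwiches {S : Type*} [Monoid S]
    (h : HasAtMostLinearGrowth S) : IsFiniteUnionOfSandwiches S := by
  obtain ⟨G, hG, hgen, C, hC⟩ := h
  obtain ⟨k, f, -, rfl⟩ := hG.fin_param
  obtain ⟨m, hm⟩ := exists_ncard_minimalWords_le f hC
  have := (List.finite_length_le (Fin k) (2 * m)).to_subtype
  let B := {l : List (Fin k) // l ∈ {l : List (Fin k) | l.length ≤ 2 * m}}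
  refine isFiniteUnionOfSandwiches_of_finite (ι := B × B × B) (fun i => (i.1.1.map f).prod)
    (fun i => (i.2.1.1.map f).prod) (fun i => (i.2.2.1.map f).prod) fun s => ?_
  obtain ⟨v, hv, rfl⟩ := exists_minimalWord f hgen s
  have hsub : {g : List (Fin k) | g <:+: v ∧ g.length = m} ⊆
      {v ∈ minimalWords f | v.length = m} := fun g hg => ⟨mem_minimalWords_of_infix hv hg.1, hg.2⟩
  have hfin : {v ∈ minimalWords f | v.length = m}.Finite :=
    (List.finite_length_eq (Fin k) m).subset fun v hv => hv.2
  obtain ⟨x, u, y, n, hx, hu, hy, rfl⟩ := exists_power_form v m (hfin.subset hsub)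
    ((Set.ncard_le_ncard hsub hfin).trans hm)
  exact ⟨(⟨x, hx⟩, ⟨u, hu⟩, ⟨y, hy⟩), n, by simp [List.prod_flatten, mul_assoc]⟩

/-! ### Homogeneous presentations with an optional zero -/

@[simp] theorem wordWeight_one {X : Type*} (d : X → ℕ) : wordWeight d 1 = 0 := by
  simp [wordWeight]

@[simp] theorem wordWeight_of {X : Type*} (d : X → ℕ) (x : X) :
    wordWeight d (FreeMonoid.of x) = d x := by
  simp [wordWeight]

@[simp] theorem wordWeight_mul {X : Type*} (d : X → ℕ) (v w : FreeMonoid X) :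
    wordWeight d (v * w) = wordWeight d v + wordWeight d w := by
  simp [wordWeight]

@[simp] theorem wordWeight_pow {X : Type*} (d : X → ℕ) (v : FreeMonoid X) (n : ℕ) :
    wordWeight d (v ^ n) = n * wordWeight d v := by
  induction n with
  | zero => simp
  | succ n ih => rw [pow_succ, wordWeight_mul, ih]; ring

theorem length_le_wordWeight {X : Type*} {d : X → ℕ} (hd : ∀ x, 0 < d x) (v : FreeMonoid X) :
    v.length ≤ wordWeight d v := by
  induction v using FreeMonoid.inductionOn' with
  | one => simp
  | of_mul x v ih =>
    have := hd x
    simp only [FreeMonoid.length_mul, FreeMonoid.length_of, wordWeight_mul, wordWeight_of]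
    omega

theorem finite_wordWeight_lt {X : Type*} [Finite X] {d : X → ℕ} (hd : ∀ x, 0 < d x) (n : ℕ) :
    {v : FreeMonoid X | wordWeight d v < n}.Finite :=
  (List.finite_length_lt X n).subset fun v hv => (length_le_wordWeight hd v).trans_lt hv

/-- A homogeneous finite presentation of `S`, with or without zero. The words map to `S` by `π`; the
set `Z` is empty for a presentation without zero and consists of the zero for a presentation with
zero. The set `rels` holds the relations between words, the set `nulls` the words that are put equal
to zero. Two words have the same value if and only if the relations `rels` identify them or both
values lie in `Z`, and a word has its value in `Z` if and only if `rels` identifies it with a word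
that has a factor in `nulls`. -/
structure GradedPresentation (S : Type*) [Monoid S] where
  k : ℕ
  d : Fin k → ℕ
  rels : Set (FreeMonoid (Fin k) × FreeMonoid (Fin k))
  nulls : Set (FreeMonoid (Fin k))
  π : FreeMonoid (Fin k) →* S
  Z : Set S
  d_pos : ∀ x, 0 < d x
  finite_rels : rels.Finite
  finite_nulls : nulls.Finite
  weight_rels : ∀ p ∈ rels, wordWeight d p.1 = wordWeight d p.2
  subsingleton_Z : Z.Subsingleton
  mul_mem_left : ∀ s t, t ∈ Z → s * t ∈ Z
  mul_mem_right : ∀ s t, s ∈ Z → s * t ∈ Z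
  mem_or_exists : ∀ s, s ∈ Z ∨ ∃ v, π v = s
  π_eq_of_rel : ∀ p ∈ rels, π p.1 = π p.2
  π_mem_of_null : ∀ w ∈ nulls, π w ∈ Z
  con_or_mem : ∀ v v', π v = π v' → conGen (fun a b => (a, b) ∈ rels) v v' ∨ π v ∈ Z
  null_of_mem : ∀ v, π v ∈ Z →
    ∃ a, ∃ w ∈ nulls, ∃ b, conGen (fun a b => (a, b) ∈ rels) v (a * w * b)

theorem HasFiniteHomogeneousPresentation.nonempty_gradedPresentation {S : Type*} [Monoid S]
    (h : HasFiniteHomogeneousPresentation S) : Nonempty (GradedPresentation S) := by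
  obtain ⟨k, d, R, hd, hR, hw, ⟨e⟩⟩ := h
  refine ⟨{ k := k, d := d, rels := R, nulls := ∅, Z := ∅
            π := e.toMonoidHom.comp (PresentedMonoid.mk _)
            d_pos := hd, finite_rels := hR, finite_nulls := Set.finite_empty, weight_rels := hw
            subsingleton_Z := Set.subsingleton_empty
            mul_mem_left := by simp
            mul_mem_right := by simp
            mem_or_exists := fun s => ?_
            π_eq_of_rel := fun p hp => ?_
            π_mem_of_null := by simp
            con_or_mem := fun v v' h => Or.inl ?_
            null_of_mem := by simp }⟩
  · obtain ⟨v, hv⟩ := PresentedMonoid.surjective_mk (e.symm s)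
    exact Or.inr ⟨v, by simp [hv]⟩
  · exact congrArg e ((Con.eq _).2 (ConGen.Rel.of _ _ hp))
  · exact (Con.eq _).1 (e.injective h)

/-- In a free monoid with zero, the elements that the relations make zero: the zero itself and the
words that `R` identifies with a word that has a factor in `N`. The condition quantifies over the
words `v` equal to `x`, so that it holds vacuously for the zero. -/
def IsNull {X : Type*} (R : Set (FreeMonoid X × FreeMonoid X)) (N : Set (FreeMonoid X))
    (x : WithZero (FreeMonoid X)) : Prop :=
  ∀ v : FreeMonoid X, x = v →
    ∃ a, ∃ w ∈ N, ∃ b, conGen (fun a b => (a, b) ∈ R) v (a * w * b)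

theorem IsNull.mul_left {X : Type*} {R : Set (FreeMonoid X × FreeMonoid X)}
    {N : Set (FreeMonoid X)} {y : WithZero (FreeMonoid X)} (h : IsNull R N y)
    (x : WithZero (FreeMonoid X)) : IsNull R N (x * y) := by
  intro v hv
  induction x using WithZero.recZeroCoe with
  | zero => simp at hv
  | coe x =>
    induction y using WithZero.recZeroCoe with
    | zero => simp at hv
    | coe y =>
      obtain ⟨a, w, hw, b, hab⟩ := h y rfl
      rw [← WithZero.coe_mul, WithZero.coe_inj] at hv
      subst hv
      exact ⟨x * a, w, hw, b, by simpa only [mul_assoc] using (Con.mul _ (Con.refl _ x) hab)⟩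

theorem IsNull.mul_right {X : Type*} {R : Set (FreeMonoid X × FreeMonoid X)}
    {N : Set (FreeMonoid X)} {x : WithZero (FreeMonoid X)} (h : IsNull R N x)
    (y : WithZero (FreeMonoid X)) : IsNull R N (x * y) := by
  intro v hv
  induction x using WithZero.recZeroCoe with
  | zero => simp at hv
  | coe x =>
    induction y using WithZero.recZeroCoe with
    | zero => simp at hv
    | coe y =>
      obtain ⟨a, w, hw, b, hab⟩ := h x rfl
      rw [← WithZero.coe_mul, WithZero.coe_inj] at hv
      subst hv
      exact ⟨a, w, hw, b * y, by simpa only [mul_assoc] using (Con.mul _ hab (Con.refl _ y))⟩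

theorem isNull_zero {X : Type*} (R : Set (FreeMonoid X × FreeMonoid X)) (N : Set (FreeMonoid X)) :
    IsNull R N 0 := fun _ h => absurd h.symm WithZero.coe_ne_zero

theorem IsNull.of_con {X : Type*} {R : Set (FreeMonoid X × FreeMonoid X)}
    {N : Set (FreeMonoid X)} {v v' : FreeMonoid X} (h : IsNull R N v)
    (hc : conGen (fun a b => (a, b) ∈ R) v' v) : IsNull R N v' := by
  intro u hu
  obtain ⟨a, w, hw, b, hab⟩ := h v rfl
  rw [WithZero.coe_inj] at hu
  exact ⟨a, w, hw, b, hu ▸ Con.trans _ hc hab⟩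

/-- The congruence on the free monoid with zero that identifies words as `R` does and puts the words
with a factor in `N` equal to zero. -/
def nullCon {X : Type*} (R : Set (FreeMonoid X × FreeMonoid X)) (N : Set (FreeMonoid X)) :
    Con (WithZero (FreeMonoid X)) where
  r x y := (∃ v v' : FreeMonoid X, x = v ∧ y = v' ∧ conGen (fun a b => (a, b) ∈ R) v v') ∨
    (IsNull R N x ∧ IsNull R N y)
  iseqv :=
    { refl := fun x => by
        induction x using WithZero.recZeroCoe with
        | zero => exact Or.inr ⟨isNull_zero R N, isNull_zero R N⟩
        | coe x => exact Or.inl ⟨x, x, rfl, rfl, Con.refl _ x⟩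
      symm := by
        rintro x y (⟨v, v', hx, hy, h⟩ | ⟨hx, hy⟩)
        · exact Or.inl ⟨v', v, hy, hx, Con.symm _ h⟩
        · exact Or.inr ⟨hy, hx⟩
      trans := by
        rintro x y z (⟨v, v', rfl, rfl, h⟩ | ⟨hx, hy⟩) (⟨u, u', hy', rfl, h'⟩ | ⟨hy', hz⟩)
        · rw [WithZero.coe_inj] at hy'
          subst hy'
          exact Or.inl ⟨v, u', rfl, rfl, Con.trans _ h h'⟩
        · exact Or.inr ⟨hy'.of_con h, hz⟩
        · subst hy'
          exact Or.inr ⟨hx, hy.of_con (Con.symm _ h')⟩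
        · exact Or.inr ⟨hx, hz⟩ }
  mul' := by
    rintro x y z t (⟨v, v', rfl, rfl, h⟩ | ⟨hx, hy⟩) (⟨u, u', rfl, rfl, h'⟩ | ⟨hy', hz⟩)
    · exact Or.inl ⟨v * u, v' * u', by simp, by simp, Con.mul _ h h'⟩
    · exact Or.inr ⟨hy'.mul_left _, hz.mul_left _⟩
    · exact Or.inr ⟨hx.mul_right _, hy.mul_right _⟩
    · exact Or.inr ⟨hx.mul_right _, hy.mul_right _⟩

theorem HasFiniteHomogeneousPresentationWithZero.nonempty_gradedPresentation {S : Type*} [Monoid S]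
    (h : HasFiniteHomogeneousPresentationWithZero S) : Nonempty (GradedPresentation S) := by
  obtain ⟨k, d, R, hd, hR, hw, ⟨e⟩⟩ := h
  let c : Con (WithZero (FreeMonoid (Fin k))) := conGen (fun w u => (w, u) ∈ R)
  let q : WithZero (FreeMonoid (Fin k)) →* S := (e : c.Quotient →* S).comp c.mk'
  let R' : Set (FreeMonoid (Fin k) × FreeMonoid (Fin k)) :=
    {p | ((p.1 : WithZero (FreeMonoid (Fin k))), (p.2 : WithZero (FreeMonoid (Fin k)))) ∈ R}
  let N : Set (FreeMonoid (Fin k)) := {w | ((w : WithZero (FreeMonoid (Fin k))), 0) ∈ R}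
  have hq : ∀ x y, q x = q y → nullCon R' N x y := by
    intro x y hxy
    have hc : c x y := (Con.eq c).1 (e.injective hxy)
    refine (Con.conGen_le.2 ?_ : c ≤ nullCon R' N) hc
    intro x y hxy
    rcases hw _ hxy with ⟨w, u, hp, -⟩ | ⟨w, hp⟩
    · simp only [Prod.mk.injEq] at hp
      obtain ⟨rfl, rfl⟩ := hp
      exact Or.inl ⟨w, u, rfl, rfl, ConGen.Rel.of _ _ hxy⟩
    · simp only [Prod.mk.injEq] at hp
      obtain ⟨rfl, rfl⟩ := hp
      refine Or.inr ⟨fun v hv => ⟨1, w, hxy, 1, ?_⟩, isNull_zero _ _⟩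
      rw [WithZero.coe_inj] at hv
      simpa [hv] using Con.refl _ v
  have hqR : ∀ x y, (x, y) ∈ R → q x = q y := fun x y hxy =>
    congrArg e ((Con.eq c).2 (ConGen.Rel.of _ _ hxy))
  have hqsurj : ∀ s, ∃ x, q x = s := by
    intro s
    obtain ⟨x, hx⟩ := Con.mk'_surjective (e.symm s)
    exact ⟨x, (congrArg e hx).trans (e.apply_symm_apply s)⟩
  have hmem : ∀ v : FreeMonoid (Fin k), q v ∈ ({q 0} : Set S) → IsNull R' N v := by
    intro v hv
    rcases hq _ _ hv with ⟨_, v', _, h0, _⟩ | ⟨h, -⟩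
    · exact absurd h0.symm WithZero.coe_ne_zero
    · exact h
  have hzl : ∀ s, s * q 0 = q 0 := fun s => by
    obtain ⟨x, rfl⟩ := hqsurj s
    rw [← map_mul, mul_zero]
  have hzr : ∀ s, q 0 * s = q 0 := fun s => by
    obtain ⟨x, rfl⟩ := hqsurj s
    rw [← map_mul, zero_mul]
  refine ⟨{ k := k, d := d, rels := R', nulls := N, Z := {q 0}
            π := q.comp (WithZero.coeMonoidHom : FreeMonoid (Fin k) →* _)
            d_pos := hd
            finite_rels := hR.preimage fun p _ p' _ h => ?_
            finite_nulls := hR.preimage fun p _ p' _ h => ?_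
            weight_rels := fun p hp => ?_
            subsingleton_Z := Set.subsingleton_singleton
            mul_mem_left := fun s t ht => by rw [Set.mem_singleton_iff.1 ht, hzl]; rfl
            mul_mem_right := fun s t hs => by rw [Set.mem_singleton_iff.1 hs, hzr]; rfl
            mem_or_exists := fun s => ?_
            π_eq_of_rel := fun p hp => hqR _ _ hp
            π_mem_of_null := fun w hw => hqR _ _ hw
            con_or_mem := fun v v' h => ?_
            null_of_mem := fun v hv => hmem v hv v rfl }⟩
  · simpa [Prod.ext_iff] using h
  · simpa using h
  · rcases hw _ hp with ⟨w, u, h, h'⟩ | ⟨w, h⟩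
    · simp only [Prod.mk.injEq, WithZero.coe_inj] at h
      rw [h.1, h.2, h']
    · simp at h
  · obtain ⟨x, rfl⟩ := hqsurj s
    induction x using WithZero.recZeroCoe with
    | zero => exact Or.inl rfl
    | coe x => exact Or.inr ⟨x, rfl⟩
  · rcases hq _ _ h with ⟨u, u', hu, hu', h⟩ | ⟨hn, -⟩
    · obtain rfl : v = u := WithZero.coe_inj.1 hu
      obtain rfl : v' = u' := WithZero.coe_inj.1 hu'
      exact Or.inl h
    · obtain ⟨a, w, hw, b, hab⟩ := hn v rfl
      have h1 : c.comap (WithZero.coeMonoidHom : FreeMonoid (Fin k) →* _) (map_mul _) v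
          (a * w * b) := by
        refine (Con.conGen_le.2 ?_ : conGen (fun a b => (a, b) ∈ R') ≤ _) hab
        intro x y hxy
        exact ConGen.Rel.of _ _ hxy
      have h2 : q v = q (a * w * b) := congrArg e ((Con.eq c).2 (by simpa using h1))
      refine Or.inr (?_ : q v = q 0)
      rw [h2, map_mul, map_mul, hqR _ _ hw, hzl, hzr]

theorem IsHomogeneousFinitelyPresented.nonempty_gradedPresentation {S : Type*} [Monoid S]
    (h : IsHomogeneousFinitelyPresented S) : Nonempty (GradedPresentation S) :=
  h.elim HasFiniteHomogeneousPresentation.nonempty_gradedPresentation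
    HasFiniteHomogeneousPresentationWithZero.nonempty_gradedPresentation

namespace GradedPresentation

variable {S : Type*} [Monoid S] (P : GradedPresentation S)

/-- The weight of a word, for the weights of the presentation `P`. -/
abbrev wt (v : FreeMonoid (Fin P.k)) : ℕ := wordWeight P.d v

theorem wt_eq_of_con {v v' : FreeMonoid (Fin P.k)}
    (h : conGen (fun a b => (a, b) ∈ P.rels) v v') : P.wt v = P.wt v' := by
  have h' : ConGen.Rel (fun a b => (a, b) ∈ P.rels) v v' := h
  clear h
  induction h' with
  | of x y h => exact P.weight_rels _ h
  | refl => rfl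
  | symm _ ih => exact ih.symm
  | trans _ _ ih₁ ih₂ => exact ih₁.trans ih₂
  | mul _ _ ih₁ ih₂ => simp only [wt, wordWeight_mul] at *; rw [ih₁, ih₂]

theorem wt_eq_of_π_eq {v v' : FreeMonoid (Fin P.k)} (h : P.π v = P.π v') (hZ : P.π v ∉ P.Z) :
    P.wt v = P.wt v' :=
  P.wt_eq_of_con ((P.con_or_mem v v' h).resolve_right hZ)

theorem mem_of_mul_mem {s t u : S} (h : s ∈ P.Z ∨ t ∈ P.Z ∨ u ∈ P.Z) : s * t * u ∈ P.Z := by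
  rcases h with h | h | h
  · exact P.mul_mem_right _ _ (P.mul_mem_right _ _ h)
  · exact P.mul_mem_right _ _ (P.mul_mem_left _ _ h)
  · exact P.mul_mem_left _ _ h

/-- All words for a given nonzero element have the same weight, so these weights are bounded. -/
theorem exists_wt_lt (s : S) : ∃ B, ∀ v, P.π v = s → P.π v ∉ P.Z → P.wt v < B := by
  by_cases h : ∃ v, P.π v = s
  · obtain ⟨v, rfl⟩ := h
    exact ⟨P.wt v + 1, fun v' hv' hZ => by rw [P.wt_eq_of_π_eq hv' hZ]; omega⟩
  · exact ⟨0, fun v hv => absurd ⟨v, hv⟩ h⟩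

theorem eq_one_of_wt_eq_zero {v : FreeMonoid (Fin P.k)} (h : P.wt v = 0) : v = 1 := by
  have := length_le_wordWeight P.d_pos v
  exact FreeMonoid.length_eq_zero.1 (by simp only [wt] at h; omega)

/-! ### Extending the action of the letters from a window of weights -/

theorem exists_split {n ρ : ℕ} (hρ : ∀ x, P.d x ≤ ρ) (b : FreeMonoid (Fin P.k)) :
    ∀ a : FreeMonoid (Fin P.k), P.wt a < n + ρ → n ≤ P.wt (a * b) →
      ∃ b₁ b₂, b = b₁ * b₂ ∧ n ≤ P.wt (a * b₁) ∧ P.wt (a * b₁) < n + ρ := by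
  induction b using FreeMonoid.inductionOn' with
  | one => exact fun a ha hn => ⟨1, 1, by simp, hn, by simpa using ha⟩
  | of_mul x b ih =>
    intro a ha hn
    by_cases h : n ≤ P.wt a
    · exact ⟨1, FreeMonoid.of x * b, by simp, by simpa using h, by simpa using ha⟩
    · obtain ⟨b₁, b₂, rfl, h₁, h₂⟩ := ih (a * FreeMonoid.of x)
        (by have := hρ x; simp only [wt, wordWeight_mul, wordWeight_of] at *; omega)
        (by rwa [mul_assoc])
      exact ⟨FreeMonoid.of x * b₁, b₂, by rw [mul_assoc], by rwa [← mul_assoc],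
        by rwa [← mul_assoc]⟩

/-- `P.Transfers n ρ g h` says that `g` labels all elements of weight in the window `[n, n + ρ)`,
and that every identity `g α * y = g β` with a word `y` of weight below `ρ`, and every `g α ∈ Z`,
remains true when `g` is replaced with `h`. -/
structure Transfers (n ρ : ℕ) {Λ : Type*} (g h : Λ → S) : Prop where
  cover : ∀ v, n ≤ P.wt v → P.wt v < n + ρ → ∃ α, P.π v = g α
  mul : ∀ α β y, P.wt y < ρ → g α * P.π y = g β → h α * P.π y = h β
  zero : ∀ α, g α ∈ P.Z → h α ∈ P.Z

/-- The graph of the map from words of weight at least `n` to `S` that sends the label `g α` of a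
word in the window to `h α` and commutes with right multiplication by words. -/
def TransferRel (n ρ : ℕ) {Λ : Type*} (g h : Λ → S) (v : FreeMonoid (Fin P.k)) (s : S) : Prop :=
  ∃ v₀ u α, v = v₀ * u ∧ n ≤ P.wt v₀ ∧ P.wt v₀ < n + ρ ∧ P.π v₀ = g α ∧ s = h α * P.π u

variable {P} {n ρ : ℕ} {Λ : Type*} {g h : Λ → S}

theorem TransferRel.mul_right {v : FreeMonoid (Fin P.k)} {s : S}
    (hv : P.TransferRel n ρ g h v s) (u : FreeMonoid (Fin P.k)) :
    P.TransferRel n ρ g h (v * u) (s * P.π u) := by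
  obtain ⟨v₀, u₀, α, rfl, h₁, h₂, h₃, rfl⟩ := hv
  exact ⟨v₀, u₀ * u, α, by rw [mul_assoc], h₁, h₂, h₃, by rw [map_mul, mul_assoc]⟩

theorem Transfers.exists_transferRel (H : P.Transfers n ρ g h) (hρ : ∀ x, P.d x ≤ ρ) (h0 : 0 < ρ)
    {v : FreeMonoid (Fin P.k)} (hv : n ≤ P.wt v) : ∃ s, P.TransferRel n ρ g h v s := by
  obtain ⟨v₀, u, rfl, h₁, h₂⟩ := P.exists_split (n := n) hρ v 1 (by simp; omega) (by simpa using hv)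
  rw [one_mul] at h₁ h₂
  obtain ⟨α, hα⟩ := H.cover v₀ h₁ h₂
  exact ⟨_, v₀, u, α, rfl, h₁, h₂, hα, rfl⟩

theorem Transfers.transferRel_unique (H : P.Transfers n ρ g h) {v : FreeMonoid (Fin P.k)} {s t : S}
    (hs : P.TransferRel n ρ g h v s) (ht : P.TransferRel n ρ g h v t) : s = t := by
  have key : ∀ (v₀ y u : FreeMonoid (Fin P.k)) (α β : Λ), n ≤ P.wt v₀ → P.wt (v₀ * y) < n + ρ →
      P.π v₀ = g α → P.π (v₀ * y) = g β → h α * P.π (y * u) = h β * P.π u := by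
    intro v₀ y u α β h₁ h₂ hα hβ
    rw [map_mul, ← mul_assoc, H.mul α β y]
    · simp only [wt, wordWeight_mul] at *; omega
    · rw [← hα, ← map_mul, hβ]
  obtain ⟨v₀, u, α, rfl, h₁, h₂, hα, rfl⟩ := hs
  obtain ⟨v₁, u', β, heq, h₁', h₂', hβ, rfl⟩ := ht
  rcases List.append_eq_append_iff.1 heq with ⟨(y : FreeMonoid (Fin P.k)), h3, h4⟩ |
    ⟨(y : FreeMonoid (Fin P.k)), h3, h4⟩
  · obtain rfl : v₁ = v₀ * y := h3
    obtain rfl : u = y * u' := h4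
    exact key v₀ y u' α β h₁ h₂' hα hβ
  · obtain rfl : v₀ = v₁ * y := h3
    obtain rfl : u' = y * u := h4
    exact (key v₁ y u β α h₁' h₂ hβ hα).symm

/-- Since `ρ` is at least the weight of each relation, one application of a relation either takes place
inside the window or to the right of a prefix of weight at least `n`. -/
theorem Transfers.eq_of_con (H : P.Transfers n ρ g h) (hρ : ∀ x, P.d x ≤ ρ) (h0 : 0 < ρ)
    (hR : ∀ p ∈ P.rels, P.wt p.1 ≤ ρ) {v v' : FreeMonoid (Fin P.k)}
    (hc : conGen (fun a b => (a, b) ∈ P.rels) v v') :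
    ∀ (a b : FreeMonoid (Fin P.k)) (s t : S), n ≤ P.wt (a * v * b) →
      P.TransferRel n ρ g h (a * v * b) s → P.TransferRel n ρ g h (a * v' * b) t → s = t := by
  have hc' : ConGen.Rel (fun a b => (a, b) ∈ P.rels) v v' := hc
  clear hc
  induction hc' with
  | of x y hxy =>
    intro a b s t hn hs ht
    have hπ : P.π x = P.π y := P.π_eq_of_rel _ hxy
    have hw : P.wt x = P.wt y := P.weight_rels _ hxy
    by_cases ha : n ≤ P.wt a
    · obtain ⟨s₀, hs₀⟩ := H.exists_transferRel hρ h0 ha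
      rw [H.transferRel_unique hs ((hs₀.mul_right x).mul_right b), hπ,
        H.transferRel_unique ht ((hs₀.mul_right y).mul_right b)]
    · have hx := hR _ hxy
      obtain ⟨b₁, b₂, rfl, h₁, h₂⟩ := P.exists_split (n := n) hρ b (a * x)
        (by simp only [wt, wordWeight_mul] at *; omega) hn
      obtain ⟨α, hα⟩ := H.cover _ h₁ h₂
      have hs' : P.TransferRel n ρ g h (a * x * (b₁ * b₂)) (h α * P.π b₂) :=
        ⟨a * x * b₁, b₂, α, by simp only [mul_assoc], h₁, h₂, hα, rfl⟩
      have ht' : P.TransferRel n ρ g h (a * y * (b₁ * b₂)) (h α * P.π b₂) := by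
        refine ⟨a * y * b₁, b₂, α, by simp only [mul_assoc], ?_, ?_, ?_, rfl⟩
        · simp only [wt, wordWeight_mul] at *; omega
        · simp only [wt, wordWeight_mul] at *; omega
        · rw [← hα]; simp only [map_mul, hπ]
      rw [H.transferRel_unique hs hs', H.transferRel_unique ht ht']
  | refl => intro a b s t _ hs ht; exact H.transferRel_unique hs ht
  | symm h ih =>
    intro a b s t hn hs ht
    have := P.wt_eq_of_con h
    exact (ih a b t s (by simp only [wt, wordWeight_mul] at *; omega) ht hs).symm
  | @trans x y z h₁ _ ih₁ ih₂ =>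
    intro a b s t hn hs ht
    have := P.wt_eq_of_con h₁
    have hn' : n ≤ P.wt (a * y * b) := by
      simp only [wt, wordWeight_mul] at hn this ⊢; rw [this] at hn; exact hn
    obtain ⟨r, hr⟩ := H.exists_transferRel hρ h0 hn'
    exact (ih₁ a b s r hn hs hr).trans (ih₂ a b r t hn' hr ht)
  | @mul w x y z h₁ h₂ ih₁ ih₂ =>
    intro a b s t hn hs ht
    have h₁ := P.wt_eq_of_con h₁
    have hn' : n ≤ P.wt (a * x * (y * b)) := by
      simp only [wt, wordWeight_mul] at *; omega
    obtain ⟨r, hr⟩ := H.exists_transferRel hρ h0 hn'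
    have e₁ : a * (w * y) * b = a * w * (y * b) := by simp only [mul_assoc]
    have e₂ : a * x * (y * b) = a * x * y * b := by simp only [mul_assoc]
    have e₃ : a * (x * z) * b = a * x * z * b := by simp only [mul_assoc]
    rw [e₁] at hs hn
    rw [e₃] at ht
    refine (ih₁ a (y * b) s r hn hs hr).trans (ih₂ (a * x) b r t ?_ ?_ ht)
    · rwa [← e₂]
    · rwa [← e₂]

theorem Transfers.mem_of_mem (H : P.Transfers n ρ g h) (hρ : ∀ x, P.d x ≤ ρ) (h0 : 0 < ρ)
    (hR : ∀ p ∈ P.rels, P.wt p.1 ≤ ρ) (hN : ∀ w ∈ P.nulls, P.wt w ≤ ρ)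
    {v : FreeMonoid (Fin P.k)} (hn : n ≤ P.wt v) {s : S} (hs : P.TransferRel n ρ g h v s)
    (hv : P.π v ∈ P.Z) : s ∈ P.Z := by
  obtain ⟨a, w, hw, b, hab⟩ := P.null_of_mem v hv
  have hn' : n ≤ P.wt (a * w * b) := by rwa [← P.wt_eq_of_con hab]
  obtain ⟨t, ht⟩ := H.exists_transferRel hρ h0 hn'
  have hst : s = t := H.eq_of_con hρ h0 hR hab 1 1 s t (by simpa using hn) (by simpa using hs)
    (by simpa using ht)
  subst hst
  have hwZ := P.π_mem_of_null w hw
  by_cases ha : n ≤ P.wt a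
  · obtain ⟨s₀, hs₀⟩ := H.exists_transferRel hρ h0 ha
    rw [H.transferRel_unique ht ((hs₀.mul_right w).mul_right b)]
    exact P.mem_of_mul_mem (Or.inr (Or.inl hwZ))
  · have hx := hN w hw
    obtain ⟨b₁, b₂, rfl, h₁, h₂⟩ := P.exists_split (n := n) hρ b (a * w)
      (by simp only [wt, wordWeight_mul] at *; omega) hn'
    obtain ⟨α, hα⟩ := H.cover _ h₁ h₂
    have ht' : P.TransferRel n ρ g h (a * w * (b₁ * b₂)) (h α * P.π b₂) :=
      ⟨a * w * b₁, b₂, α, by simp only [mul_assoc], h₁, h₂, hα, rfl⟩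
    rw [H.transferRel_unique ht ht']
    refine P.mul_mem_right _ _ (H.zero α ?_)
    rw [← hα, map_mul, map_mul]
    exact P.mem_of_mul_mem (Or.inr (Or.inl hwZ))

/-- The labels `g` may be replaced with `h` in all identities between right multiples, not only in
those that stay within the window. -/
theorem Transfers.mul_eq_mul (H : P.Transfers n ρ g h) (hρ : ∀ x, P.d x ≤ ρ) (h0 : 0 < ρ)
    (hR : ∀ p ∈ P.rels, P.wt p.1 ≤ ρ) (hN : ∀ w ∈ P.nulls, P.wt w ≤ ρ)
    {v v' : FreeMonoid (Fin P.k)} {α β : Λ} (hv : n ≤ P.wt v) (hv₂ : P.wt v < n + ρ)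
    (hv' : n ≤ P.wt v') (hv₂' : P.wt v' < n + ρ) (hα : P.π v = g α) (hβ : P.π v' = g β)
    (u u' : FreeMonoid (Fin P.k)) (heq : g α * P.π u = g β * P.π u') :
    h α * P.π u = h β * P.π u' := by
  have h₁ : P.TransferRel n ρ g h (v * u) (h α * P.π u) := ⟨v, u, α, rfl, hv, hv₂, hα, rfl⟩
  have h₂ : P.TransferRel n ρ g h (v' * u') (h β * P.π u') :=
    ⟨v', u', β, rfl, hv', hv₂', hβ, rfl⟩
  have hn₁ : n ≤ P.wt (v * u) := by simp only [wt, wordWeight_mul] at *; omega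
  have hn₂ : n ≤ P.wt (v' * u') := by simp only [wt, wordWeight_mul] at *; omega
  rw [← hα, ← hβ, ← map_mul, ← map_mul] at heq
  rcases P.con_or_mem _ _ heq with hc | hZ
  · exact H.eq_of_con hρ h0 hR hc 1 1 _ _ (by simpa using hn₁) (by simpa using h₁)
      (by simpa using h₂)
  · exact P.subsingleton_Z (H.mem_of_mem hρ h0 hR hN hn₁ h₁ hZ)
      (H.mem_of_mem hρ h0 hR hN hn₂ h₂ (heq ▸ hZ))

theorem Transfers.mul_mem (H : P.Transfers n ρ g h) (hρ : ∀ x, P.d x ≤ ρ) (h0 : 0 < ρ)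
    (hR : ∀ p ∈ P.rels, P.wt p.1 ≤ ρ) (hN : ∀ w ∈ P.nulls, P.wt w ≤ ρ)
    {v : FreeMonoid (Fin P.k)} {α : Λ} (hv : n ≤ P.wt v) (hv₂ : P.wt v < n + ρ)
    (hα : P.π v = g α) (u : FreeMonoid (Fin P.k)) (hmem : g α * P.π u ∈ P.Z) :
    h α * P.π u ∈ P.Z := by
  refine H.mem_of_mem hρ h0 hR hN (v := v * u) ?_ ⟨v, u, α, rfl, hv, hv₂, hα, rfl⟩ ?_
  · simp only [wt, wordWeight_mul] at *; omega
  · rwa [map_mul, hα]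

end GradedPresentation

/-! ### Sandwiches of equal period -/

theorem exists_bound {ι : Type*} [Finite ι] (f : ι → ℕ) : ∃ B, ∀ i, f i ≤ B := by
  obtain ⟨B, hB⟩ := (Set.finite_range f).bddAbove
  exact ⟨B, fun i => hB ⟨i, rfl⟩⟩

namespace GradedPresentation

variable {S : Type*} [Monoid S]

/-- Finitely many sandwiches `a i⟨w i⟩b i` that contain all nonzero elements of weight at least `c`,
normalized so that all words `w i` have the same weight `E` and all weights `d(a i) + d(b i)` lie in
the interval `[c, c + E)`. Thus the exponent `n` can be read off from the weight of a nonzero element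
`a i * w i ^ n * b i`. -/
structure UniformCover (P : GradedPresentation S) where
  ι : Type
  finite_ι : Finite ι
  E : ℕ
  c : ℕ
  a : ι → FreeMonoid (Fin P.k)
  w : ι → FreeMonoid (Fin P.k)
  b : ι → FreeMonoid (Fin P.k)
  E_pos : 0 < E
  wt_w : ∀ i, P.wt (w i) = E
  le_wt : ∀ i, c ≤ P.wt (a i) + P.wt (b i)
  wt_lt : ∀ i, P.wt (a i) + P.wt (b i) < c + E
  cover : ∀ v, P.π v ∉ P.Z → c ≤ P.wt v → ∃ i n, P.π v = P.π (a i * w i ^ n * b i)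

/-- A sandwich has bounded weight outside `Z` unless it comes from words `a`, `w`, `b` with `w` of
positive weight. -/
theorem exists_words_or_bounded (P : GradedPresentation S) (a w b : S) :
    (∃ a' w' b', P.π a' = a ∧ P.π w' = w ∧ P.π b' = b ∧ 0 < P.wt w') ∨
      ∃ B, ∀ v, P.π v ∉ P.Z → P.π v ∈ sandwich a w b → P.wt v < B := by
  by_cases h : ∀ n, a * w ^ n * b ∈ P.Z ∨ a * w ^ n * b = a * b
  · obtain ⟨B, hB⟩ := P.exists_wt_lt (a * b)
    refine Or.inr ⟨B, ?_⟩
    rintro v hv ⟨n, hn⟩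
    rcases h n with h | h
    · exact absurd (hn ▸ h) hv
    · exact hB v (hn.symm.trans h) hv
  · left
    push Not at h
    obtain ⟨n, hn, hne⟩ := h
    have hn0 : n ≠ 0 := by rintro rfl; simp at hne
    have ha : a ∉ P.Z := fun h => hn (P.mem_of_mul_mem (Or.inl h))
    have hb : b ∉ P.Z := fun h => hn (P.mem_of_mul_mem (Or.inr (Or.inr h)))
    have hw : w ∉ P.Z := fun h => hn (P.mem_of_mul_mem (Or.inr (Or.inl (by
      rw [← Nat.succ_pred_eq_of_ne_zero hn0, pow_succ]
      exact P.mul_mem_left _ _ h))))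
    obtain ⟨a', rfl⟩ := (P.mem_or_exists a).resolve_left ha
    obtain ⟨b', rfl⟩ := (P.mem_or_exists b).resolve_left hb
    obtain ⟨w', rfl⟩ := (P.mem_or_exists w).resolve_left hw
    refine ⟨a', w', b', rfl, rfl, rfl, Nat.pos_of_ne_zero fun h => hne ?_⟩
    rw [P.eq_one_of_wt_eq_zero h]; simp

theorem nonempty_uniformCover (P : GradedPresentation S) (h : IsFiniteUnionOfSandwiches S) :
    Nonempty P.UniformCover := by
  classical
  obtain ⟨k, a, w, b, hcov⟩ := h
  let good : Fin k → Prop := fun i =>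
    ∃ a' w' b', P.π a' = a i ∧ P.π w' = w i ∧ P.π b' = b i ∧ 0 < P.wt w'
  have hbad : ∀ i, ∃ B, ¬ good i → ∀ v, P.π v ∉ P.Z → P.π v ∈ sandwich (a i) (w i) (b i) →
      P.wt v < B := by
    intro i
    rcases P.exists_words_or_bounded (a i) (w i) (b i) with h | ⟨B, hB⟩
    · exact ⟨0, fun h' => absurd h h'⟩
    · exact ⟨B, fun _ => hB⟩
  choose B hB using hbad
  have hgood : ∀ j : {i // good i}, good j.1 := fun j => j.2
  choose a' w' b' ha' hw' hb' hpos using hgood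
  obtain ⟨c₁, hc₁⟩ := exists_bound B
  obtain ⟨c₂, hc₂⟩ := exists_bound fun j => P.wt (a' j) + P.wt (b' j)
  let c := c₁ + c₂
  let E := ∏ j, P.wt (w' j)
  have hE : 0 < E := Finset.prod_pos fun j _ => hpos j
  have hdvd : ∀ j, ∃ q, E = P.wt (w' j) * q := fun j =>
    Finset.dvd_prod_of_mem (fun j => P.wt (w' j)) (Finset.mem_univ j)
  choose q hq using hdvd
  -- An index is a good sandwich together with the exponent at which its new copy starts.
  refine ⟨{ ι := {p : {i // good i} × Fin (c + E) //
              c ≤ P.wt (a' p.1) + p.2 * P.wt (w' p.1) + P.wt (b' p.1) ∧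
                P.wt (a' p.1) + p.2 * P.wt (w' p.1) + P.wt (b' p.1) < c + E}
            finite_ι := inferInstance, E := E, c := c
            a := fun p => a' p.1.1 * w' p.1.1 ^ (p.1.2 : ℕ)
            w := fun p => w' p.1.1 ^ q p.1.1
            b := fun p => b' p.1.1
            E_pos := hE
            wt_w := fun p => (wordWeight_pow _ _ _).trans ((mul_comm _ _).trans (hq p.1.1).symm)
            le_wt := fun p => by simpa only [wt, wordWeight_mul, wordWeight_pow] using p.2.1
            wt_lt := fun p => by simpa only [wt, wordWeight_mul, wordWeight_pow] using p.2.2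
            cover := fun v hv hcv => ?_ }⟩
  obtain ⟨i, hi⟩ := Set.mem_iUnion.1 (hcov.symm ▸ Set.mem_univ (P.π v))
  have hgi : good i := by
    by_contra hgi
    have := hB i hgi v hv hi
    have := hc₁ i
    omega
  obtain ⟨m, hm⟩ := hi
  let j : {i // good i} := ⟨i, hgi⟩
  have hm' : P.π v = P.π (a' j * w' j ^ m * b' j) := by
    simp only [map_mul, map_pow, ha', hw', hb']; exact hm.symm
  have hwt : P.wt v = P.wt (a' j) + m * P.wt (w' j) + P.wt (b' j) := by
    rw [P.wt_eq_of_π_eq hm' hv]; simp [wt]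
  have hj : P.wt (a' j) + P.wt (b' j) ≤ c₂ := hc₂ j
  obtain ⟨t, r, hr, ht⟩ : ∃ t r, r < E ∧ P.wt v - c = E * t + r :=
    ⟨_, _, Nat.mod_lt _ hE, (Nat.div_add_mod _ E).symm⟩
  have hqt : q j * t ≤ m := by
    refine Nat.le_of_mul_le_mul_left ?_ (hpos j)
    rw [← mul_assoc, ← hq j, mul_comm _ m]
    omega
  obtain ⟨l, rfl⟩ := Nat.exists_eq_add_of_le' hqt
  have hwt' : P.wt v = P.wt (a' j) + l * P.wt (w' j) + P.wt (b' j) + E * t := by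
    rw [hwt, hq j]; ring
  have hl : l ≤ l * P.wt (w' j) := Nat.le_mul_of_pos_right _ (hpos j)
  refine ⟨⟨(j, ⟨l, by omega⟩), by simp only; omega, by simp only; omega⟩, t, ?_⟩
  rw [hm', pow_add, pow_mul]
  simp only [mul_assoc, j]

namespace UniformCover

variable {P : GradedPresentation S} (U : P.UniformCover)

/-- The word `a i * w i ^ n * b i`. -/
def word (n : ℕ) (i : U.ι) : FreeMonoid (Fin P.k) := U.a i * U.w i ^ n * U.b i

theorem wt_word (n : ℕ) (i : U.ι) :
    P.wt (U.word n i) = P.wt (U.a i) + P.wt (U.b i) + U.E * n := by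
  have := U.wt_w i
  simp only [wt] at this
  simp only [word, wt, wordWeight_mul, wordWeight_pow, this]
  ring

theorem eq_of_π_word_eq {n m : ℕ} {i j : U.ι} (h : P.π (U.word n i) = P.π (U.word m j))
    (hZ : P.π (U.word n i) ∉ P.Z) : n = m := by
  have hw := P.wt_eq_of_π_eq h hZ
  rw [wt_word, wt_word] at hw
  have h₁ := U.le_wt i
  have h₂ := U.wt_lt i
  have h₃ := U.le_wt j
  have h₄ := U.wt_lt j
  rcases lt_trichotomy n m with hlt | heq | hlt
  · nlinarith [U.E_pos]
  · exact heq
  · nlinarith [U.E_pos]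

/-! ### Sandwiches give linear growth -/

theorem hasAtMostLinearGrowth (U : P.UniformCover) : HasAtMostLinearGrowth S := by
  have hZfin : P.Z.Finite := P.subsingleton_Z.finite
  have := U.finite_ι
  let G : Set S := Set.range (fun x => P.π (FreeMonoid.of x)) ∪ P.Z
  have hcl : ∀ v, P.π v ∈ Submonoid.closure G := by
    intro v
    induction v using FreeMonoid.inductionOn' with
    | one => rw [map_one]; exact Submonoid.one_mem _
    | of_mul x v ih =>
      rw [map_mul]
      exact Submonoid.mul_mem _ (Submonoid.subset_closure (Or.inl ⟨x, rfl⟩)) ih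
  obtain ⟨D, hD⟩ := exists_bound P.d
  have hlist : ∀ l : List S, (∀ x ∈ l, x ∈ G) →
      l.prod ∈ P.Z ∨ ∃ v, P.wt v ≤ D * l.length ∧ P.π v = l.prod := by
    intro l
    induction l with
    | nil => exact fun _ => Or.inr ⟨1, by simp, by simp⟩
    | cons x l ih =>
      intro hl
      rw [List.prod_cons]
      rcases ih fun y hy => hl y (List.mem_cons_of_mem _ hy) with h | ⟨v, hv, hπ⟩
      · exact Or.inl (P.mul_mem_left _ _ h)
      · rcases hl x List.mem_cons_self with ⟨y, rfl⟩ | h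
        · refine Or.inr ⟨FreeMonoid.of y * v, ?_, by rw [map_mul, hπ]⟩
          have := hD y
          simp only [wt, wordWeight_mul, wordWeight_of, List.length_cons] at *
          linarith
        · exact Or.inl (P.mul_mem_right _ _ h)
  have hsmall : (P.π '' {v | P.wt v < U.c}).Finite := (finite_wordWeight_lt P.d_pos _).image _
  refine ⟨G, (Set.finite_range _).union hZfin, ?_,
    P.Z.ncard + (P.π '' {v | P.wt v < U.c}).ncard + Nat.card U.ι * (D + 1), fun n hn => ?_⟩
  · rw [eq_top_iff]
    intro s _
    rcases P.mem_or_exists s with h | ⟨v, rfl⟩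
    · exact Submonoid.subset_closure (Or.inr h)
    · exact hcl v
  · let f : U.ι × Fin (D * n + 1) → S := fun p => P.π (U.word p.2 p.1)
    have hsub : growthBall G n ⊆ P.Z ∪ P.π '' {v | P.wt v < U.c} ∪ Set.range f := by
      rintro s ⟨l, hl, hlG, rfl⟩
      rcases hlist l hlG with h | ⟨v, hv, hπ⟩
      · exact Or.inl (Or.inl h)
      · rw [← hπ]
        by_cases hZ : P.π v ∈ P.Z
        · exact Or.inl (Or.inl hZ)
        by_cases hc : P.wt v < U.c
        · exact Or.inl (Or.inr ⟨v, hc, rfl⟩)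
        obtain ⟨i, m, him⟩ := U.cover v hZ (not_lt.1 hc)
        have hw : P.wt v = P.wt (U.word m i) := P.wt_eq_of_π_eq him hZ
        rw [wt_word] at hw
        have h1 : m ≤ U.E * m := Nat.le_mul_of_pos_left _ U.E_pos
        have h2 : D * l.length ≤ D * n := Nat.mul_le_mul_left _ hl
        exact Or.inr ⟨(i, ⟨m, by omega⟩), him.symm⟩
    have hf : (Set.range f).ncard ≤ Nat.card U.ι * (D * n + 1) := by
      rw [← Set.image_univ]
      refine (Set.ncard_image_le Set.finite_univ).trans ?_
      rw [Set.ncard_univ, Nat.card_prod, Nat.card_fin]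
    have h1 := Set.ncard_le_ncard hsub ((hZfin.union hsmall).union (Set.finite_range f))
    have h2 := Set.ncard_union_le (P.Z ∪ P.π '' {v | P.wt v < U.c}) (Set.range f)
    have h3 := Set.ncard_union_le P.Z (P.π '' {v | P.wt v < U.c})
    have h4 : P.Z.ncard + (P.π '' {v | P.wt v < U.c}).ncard ≤
        (P.Z.ncard + (P.π '' {v | P.wt v < U.c}).ncard) * n := Nat.le_mul_of_pos_right _ hn
    have h5 : Nat.card U.ι * (D * n + 1) ≤ Nat.card U.ι * (D + 1) * n := by
      rw [mul_assoc]
      exact Nat.mul_le_mul_left _ (by linarith)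
    rw [add_mul]
    omega

/-! ### Equalities between sandwich elements are eventually periodic -/

/-- Labels of the elements in a window: the shifted elements `a i * w i ^ (N + l) * b i`, the
elements `a i * w i ^ (N + c)`, and the elements of `Z`. -/
abbrev Label (ρ : ℕ) := (U.ι × Fin ρ) ⊕ U.ι ⊕ P.Z

/-- The element with a given label in the window that starts at weight `E * N + c`. -/
def value (ρ N : ℕ) : U.Label ρ → S
  | .inl (i, l) => P.π (U.word (N + l) i)
  | .inr (.inl i) => P.π (U.a i * U.w i ^ (N + U.c))
  | .inr (.inr z) => z

theorem exists_label {ρ N : ℕ} (v : FreeMonoid (Fin P.k)) (h₁ : U.E * N + U.c ≤ P.wt v)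
    (h₂ : P.wt v < U.E * N + U.c + ρ) : ∃ α, P.π v = U.value ρ N α := by
  by_cases hZ : P.π v ∈ P.Z
  · exact ⟨.inr (.inr ⟨_, hZ⟩), rfl⟩
  obtain ⟨i, m, him⟩ := U.cover v hZ (by omega)
  have hw : P.wt v = P.wt (U.word m i) := P.wt_eq_of_π_eq him hZ
  rw [wt_word] at hw
  have h₃ := U.le_wt i
  have h₄ := U.wt_lt i
  have hm : N ≤ m := by
    by_contra! hlt
    nlinarith [U.E_pos]
  obtain ⟨l, rfl⟩ := Nat.exists_eq_add_of_le hm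
  have hl : l ≤ U.E * l := Nat.le_mul_of_pos_left _ U.E_pos
  rw [mul_add] at hw
  exact ⟨.inl (i, ⟨l, by omega⟩), him⟩

/-- All identities `g α * y = g β` and `g α ∈ Z` that matter for `Transfers`, as an element of a
finite type. -/
def pattern (ρ N : ℕ) : (U.Label ρ → U.Label ρ → {y // P.wt y < ρ} → Prop) × (U.Label ρ → Prop) :=
  (fun α β y => U.value ρ N α * P.π y = U.value ρ N β, fun α => U.value ρ N α ∈ P.Z)

theorem transfers_of_pattern_eq {ρ N M : ℕ} (h : U.pattern ρ N = U.pattern ρ M) :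
    P.Transfers (U.E * N + U.c) ρ (U.value ρ N) (U.value ρ M) where
  cover v h₁ h₂ := U.exists_label v h₁ h₂
  mul α β y hy he := by
    have := congrFun (congrFun (congrFun (congrArg Prod.fst h) α) β) ⟨y, hy⟩
    exact this.mp he
  zero α hα := (congrFun (congrArg Prod.snd h) α).mp hα

/-- The pigeonhole principle gives two windows with the same pattern, and every later equality
between elements of the sandwiches is inherited from one window to the other. -/
theorem exists_period : ∃ N p, 0 < p ∧ ∀ n, N ≤ n →
    (∀ i j, P.π (U.word n i) = P.π (U.word n j) ↔
      P.π (U.word (n + p) i) = P.π (U.word (n + p) j)) ∧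
    ∀ i, P.π (U.word n i) ∈ P.Z ↔ P.π (U.word (n + p) i) ∈ P.Z := by
  have := U.finite_ι
  have := P.subsingleton_Z.finite.to_subtype
  obtain ⟨ρ₁, hρ₁⟩ := exists_bound P.d
  obtain ⟨ρ₂, hρ₂⟩ := (P.finite_rels.image fun p => P.wt p.1).bddAbove
  obtain ⟨ρ₃, hρ₃⟩ := (P.finite_nulls.image P.wt).bddAbove
  obtain ⟨ρ₄, hρ₄⟩ := exists_bound fun i => P.wt (U.a i)
  obtain ⟨ρ, hρ⟩ : ∃ ρ, ρ = ρ₁ + ρ₂ + ρ₃ + (ρ₄ + U.E * U.c) + 1 := ⟨_, rfl⟩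
  have h0 : 0 < ρ := by omega
  have hd : ∀ x, P.d x ≤ ρ := fun x => by have := hρ₁ x; omega
  have hR : ∀ p ∈ P.rels, P.wt p.1 ≤ ρ := fun p hp => by
    have : P.wt p.1 ≤ ρ₂ := hρ₂ ⟨p, hp, rfl⟩
    omega
  have hN : ∀ w ∈ P.nulls, P.wt w ≤ ρ := fun w hw => by have := hρ₃ ⟨w, hw, rfl⟩; omega
  have := (finite_wordWeight_lt P.d_pos ρ).to_subtype
  have : Finite {y // P.wt y < ρ} := this
  obtain ⟨N, M, hlt, hpat⟩ : ∃ N M, N < M ∧ U.pattern ρ N = U.pattern ρ M := by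
    obtain ⟨N, M, hne, he⟩ := Finite.exists_ne_map_eq_of_infinite (U.pattern ρ)
    rcases lt_or_gt_of_ne hne with h | h
    · exact ⟨N, M, h, he⟩
    · exact ⟨M, N, h, he.symm⟩
  have hstart : ∀ K i, U.E * K + U.c ≤ P.wt (U.a i * U.w i ^ (K + U.c)) ∧
      P.wt (U.a i * U.w i ^ (K + U.c)) < U.E * K + U.c + ρ := by
    intro K i
    have h1 : P.wt (U.a i * U.w i ^ (K + U.c)) = P.wt (U.a i) + (U.E * K + U.E * U.c) := by
      have := U.wt_w i
      simp only [wt] at this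
      simp only [wt, wordWeight_mul, wordWeight_pow, this]
      ring
    have h2 : U.c ≤ U.E * U.c := Nat.le_mul_of_pos_left _ U.E_pos
    have h3 : P.wt (U.a i) ≤ ρ₄ := hρ₄ i
    omega
  have hword : ∀ K t i, P.π (U.word (K + U.c + t) i) =
      U.value ρ K (.inr (.inl i)) * P.π (U.w i ^ t * U.b i) := by
    intro K t i
    rw [value, ← map_mul, word, pow_add _ (K + U.c)]
    simp only [mul_assoc]
  refine ⟨N + U.c, M - N, by omega, fun n hn => ?_⟩
  obtain ⟨t, rfl⟩ := Nat.exists_eq_add_of_le hn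
  have hshift : N + U.c + t + (M - N) = M + U.c + t := by omega
  have H := U.transfers_of_pattern_eq hpat
  have H' := U.transfers_of_pattern_eq hpat.symm
  rw [hshift]
  refine ⟨fun i j => ?_, fun i => ?_⟩
  · simp only [hword]
    exact ⟨H.mul_eq_mul hd h0 hR hN (hstart N i).1 (hstart N i).2 (hstart N j).1 (hstart N j).2
        rfl rfl _ _,
      H'.mul_eq_mul hd h0 hR hN (hstart M i).1 (hstart M i).2 (hstart M j).1 (hstart M j).2
        rfl rfl _ _⟩
  · simp only [hword]
    exact ⟨H.mul_mem hd h0 hR hN (hstart N i).1 (hstart N i).2 rfl _,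
      H'.mul_mem hd h0 hR hN (hstart M i).1 (hstart M i).2 rfl _⟩

/-! ### The decomposition into free sandwiches -/

theorem hasSandwichDecomposition (U : P.UniformCover) : HasSandwichDecomposition S := by
  have := U.finite_ι
  obtain ⟨N, p, hp, hper⟩ := U.exists_period
  have hperiod : ∀ j n, N ≤ n →
      (∀ i i', P.π (U.word n i) = P.π (U.word n i') ↔
        P.π (U.word (n + p * j) i) = P.π (U.word (n + p * j) i')) ∧
      ∀ i, P.π (U.word n i) ∈ P.Z ↔ P.π (U.word (n + p * j) i) ∈ P.Z := by
    intro j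
    induction j with
    | zero => intro n _; simp
    | succ j ih =>
      intro n hn
      obtain ⟨h₁, h₂⟩ := ih n hn
      obtain ⟨h₃, h₄⟩ := hper (n + p * j) (by omega)
      rw [mul_add, mul_one, ← add_assoc]
      exact ⟨fun i i' => (h₁ i i').trans (h₃ i i'), fun i => (h₂ i).trans (h₄ i)⟩
  -- The nonzero elements over one period; each of them is the start of one free sandwich.
  let T : Type := {x : U.ι × Fin p // P.π (U.word (N + x.2) x.1) ∉ P.Z}
  let val : T → S := fun x => P.π (U.word (N + x.1.2) x.1.1)
  let e := Finite.equivFin (Set.range val)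
  have hrep : ∀ s : Set.range val, ∃ t, val t = s := fun s => s.2
  choose rep hrep using hrep
  let t : Fin (Nat.card (Set.range val)) → T := fun i => rep (e.symm i)
  have ht : Function.Injective (val ∘ t) := by
    intro i j hij
    simp only [Function.comp_apply, t, hrep] at hij
    exact e.symm.injective (Subtype.ext hij)
  have hts : ∀ x : T, ∃ i, val (t i) = val x := fun x => ⟨e ⟨val x, x, rfl⟩, by
    simp only [t]; rw [hrep, Equiv.symm_apply_apply]⟩
  have hsand : ∀ (x : T) (j : ℕ),
      P.π (U.a x.1.1 * U.w x.1.1 ^ (N + x.1.2)) * P.π (U.w x.1.1 ^ p) ^ j * P.π (U.b x.1.1) =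
        P.π (U.word (N + x.1.2 + p * j) x.1.1) := by
    intro x j
    rw [← map_pow, ← map_mul, ← map_mul, word, pow_add _ (N + _), pow_mul]
    simp only [mul_assoc]
  have hnz : ∀ (x : T) (j : ℕ), P.π (U.word (N + x.1.2 + p * j) x.1.1) ∉ P.Z := fun x j h =>
    x.2 (((hperiod j _ (by omega)).2 _).2 h)
  refine ⟨P.Z ∪ P.π '' {v | P.wt v < U.c} ∪
      Set.range (fun x : U.ι × Fin N => P.π (U.word x.2 x.1)), Nat.card (Set.range val),
    fun i => P.π (U.a (t i).1.1 * U.w (t i).1.1 ^ (N + (t i).1.2)),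
    fun i => P.π (U.w (t i).1.1 ^ p), fun i => P.π (U.b (t i).1.1), ?_, ?_, ?_, ?_⟩
  · exact (P.subsingleton_Z.finite.union ((finite_wordWeight_lt P.d_pos _).image _)).union
      (Set.finite_range _)
  · intro i j j' h
    simp only [hsand] at h
    have h' := U.eq_of_π_word_eq h (hnz _ _)
    exact Nat.eq_of_mul_eq_mul_left hp (by omega)
  · intro i i' hne
    rw [Set.disjoint_left]
    rintro s ⟨j, rfl⟩ ⟨j', h⟩
    simp only [hsand] at h
    have h' := U.eq_of_π_word_eq h (hnz _ _)
    have hr₁ := (t i).1.2.2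
    have hr₂ := (t i').1.2.2
    have hj : j' = j := by
      rcases lt_trichotomy j' j with hlt | heq | hlt
      · nlinarith
      · exact heq
      · nlinarith
    subst hj
    have hr : N + ((t i').1.2 : ℕ) = N + (t i).1.2 := by omega
    rw [hr] at h
    refine hne (ht ?_)
    have := ((hperiod j' _ (by omega)).1 _ _).2 h
    simp only [Function.comp_apply, val]
    rw [← this, hr]
  · refine Set.eq_univ_of_forall fun s => ?_
    by_cases hZ : s ∈ P.Z
    · exact Or.inl (Or.inl (Or.inl hZ))
    obtain ⟨v, rfl⟩ := (P.mem_or_exists s).resolve_left hZ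
    by_cases hc : P.wt v < U.c
    · exact Or.inl (Or.inl (Or.inr ⟨v, hc, rfl⟩))
    obtain ⟨i, n, hin⟩ := U.cover v hZ (not_lt.1 hc)
    have hin : P.π v = P.π (U.word n i) := hin
    by_cases hn : n < N
    · exact Or.inl (Or.inr ⟨(i, ⟨n, hn⟩), hin.symm⟩)
    obtain ⟨j, r, hr, hnr⟩ : ∃ j r, r < p ∧ n = N + r + p * j :=
      ⟨(n - N) / p, (n - N) % p, Nat.mod_lt _ hp, by have := Nat.div_add_mod (n - N) p; omega⟩
    subst hnr
    have hx : P.π (U.word (N + r) i) ∉ P.Z := fun h =>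
      hZ (hin ▸ ((hperiod j _ (by omega)).2 _).1 h)
    obtain ⟨i', hi'⟩ := hts ⟨(i, ⟨r, hr⟩), hx⟩
    have hr' : N + ((t i').1.2 : ℕ) = N + r := U.eq_of_π_word_eq hi' (t i').2
    refine Or.inr (Set.mem_iUnion.2 ⟨i', j, ?_⟩)
    refine (hsand (t i') j).trans ?_
    rw [hin, hr']
    refine ((hperiod j (N + r) (by omega)).1 _ _).1 ?_
    simpa only [val, hr'] using hi'

end UniformCover

end GradedPresentation

/-! ### The equivalence -/

theorem HasSandwichDecomposition.isFiniteUnionOfSandwiches {S : Type*} [Monoid S]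
    (h : HasSandwichDecomposition S) : IsFiniteUnionOfSandwiches S := by
  obtain ⟨F, k, a, w, b, hF, -, -, hcov⟩ := h
  have := hF.to_subtype
  refine isFiniteUnionOfSandwiches_of_finite (ι := F ⊕ Fin k)
    (Sum.elim Subtype.val a) (Sum.elim 1 w) (Sum.elim 1 b) fun s => ?_
  rcases hcov.symm ▸ Set.mem_univ s with hs | hs
  · exact ⟨.inl ⟨s, hs⟩, 0, by simp⟩
  · obtain ⟨i, hi⟩ := Set.mem_iUnion.1 hs
    exact ⟨.inr i, hi⟩

theorem theorem1 {S : Type*} [Monoid S] (hS : IsHomogeneousFinitelyPresented S) :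
    List.TFAE
      [HasAtMostLinearGrowth S,
       IsFiniteUnionOfSandwiches S,
       HasSandwichDecomposition S] := by
  obtain ⟨P⟩ := hS.nonempty_gradedPresentation
  tfae_have 1 → 2 := HasAtMostLinearGrowth.isFiniteUnionOfSandwiches
  tfae_have 2 → 1 := fun h => (P.nonempty_uniformCover h).elim fun U => U.hasAtMostLinearGrowth
  tfae_have 2 → 3 := fun h => (P.nonempty_uniformCover h).elim fun U => U.hasSandwichDecomposition
  tfae_have 3 → 2 := HasSandwichDecomposition.isFiniteUnionOfSandwiches
  tfae_finish
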